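/- Let $A$ and $B$ be finite alphabets, $\varphi\colon A^*\to A^*$ a morphism and $a_1\in A$ a letter such that $\varphi(a_1)=a_1v$ with $\varphi^k(v)\neq\varepsilon$ for all $k\ge 0$, and let $$\varphi^\infty(a_1)=a_1v\,\varphi(v)\,\varphi^2(v)\cdots .$$ Let $\psi\colon A^*\to B^*$ be a non-erasing morphism (the image of every letter is nonempty), and put $W=\psi(\varphi^\infty(a_1))$. Assume that 1. every letter $a\in A$ is $\varphi$-growing, that is, the sequence $a,\varphi(a),\varphi^2(a),\dots$ is not eventually periodic; 2. every letter of $A$ occurs in $\varphi^\infty(a_1)$; 3. $W$ is not periodic, that is, $W$ is not of the form $uuu\cdots$ with $u$ a nonempty finite word; 4. $W$ is uniformly recurrent, that is, for every finite subword $u$ of $W$ there is $N$ such that every subword of $W$ of length $N$ contains an occurrence of $u$. Say that a letter $a$ has growth order $(d,\theta)$, where $d\in\mathbb N_0$ and $\theta>0$ is real, if there are constants $c,C>0$ with $c\,n^d\theta^n<|\varphi^n(a)|<C\,n^d\theta^n$ for all $n\ge 1$. Growth orders are compared by $(d_1,\theta_1)<(d_2,\theta_2)$ if $\theta_1<\theta_2$,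 or $\theta_1=\theta_2$ and $d_1<d_2$. Then there is a greatest growth order $(D,\Theta)$ among the growth orders of the letters of $A$, and every letter of $A$ has growth order $(D,\Theta)$. -/

import Mathlib

/-! Finite words over `A` are the elements of the free monoid `FreeMonoid A`, morphisms are monoid
homomorphisms between free monoids, infinite words are maps from `ℕ`. -/

namespace MorphicWord

variable {A B : Type*}

/-- The morphism `φ` is prolongable over the letter `a`: `φ(a) = a v`, where `φᵏ(v)` is nonempty
for every `k`. -/
def IsProlongable (φ : FreeMonoid A →* FreeMonoid A) (a : A) : Prop :=
  ∃ v : FreeMonoid A, φ (FreeMonoid.of a) = FreeMonoid.of a * v ∧ ∀ k : ℕ, φ^[k] v ≠ 1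

/-- The morphism `ψ` is non-erasing: no letter is mapped to the empty word. -/
def IsNonerasing (ψ : FreeMonoid A →* FreeMonoid B) : Prop :=
  ∀ a : A, ψ (FreeMonoid.of a) ≠ 1

theorem lt_length_iterate {φ : FreeMonoid A →* FreeMonoid A} {a : A} (h : IsProlongable φ a)
    (n : ℕ) : n < (φ^[n] (FreeMonoid.of a)).toList.length := by
  obtain ⟨v, hv, hk⟩ := h
  induction n with
  | zero => simp
  | succ n ih =>
    have h1 : φ^[n + 1] (FreeMonoid.of a) = φ^[n] (FreeMonoid.of a) * φ^[n] v := by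
      rw [Function.iterate_succ_apply, hv, iterate_map_mul]
    have h2 : 0 < (φ^[n] v).toList.length := by
      rw [List.length_pos_iff]
      intro h0
      exact hk n h0
    rw [h1, FreeMonoid.toList_mul, List.length_append]
    omega

/-- The infinite word `φ^∞(a) = a v φ(v) φ²(v) ⋯`. Every `φⁿ(a) = a v φ(v) ⋯ φⁿ⁻¹(v)` is a prefix
of it of length greater than `n`, so its letter number `n` (from `0`) can be read in `φⁿ(a)`. -/
def infiniteIterate (φ : FreeMonoid A →* FreeMonoid A) (a : A) (h : IsProlongable φ a) : ℕ → A :=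
  fun n => (φ^[n] (FreeMonoid.of a)).toList[n]'(lt_length_iterate h n)

/-- The subword of length `n` of the infinite word `X` that starts at position `i`. -/
def factor (X : ℕ → A) (i n : ℕ) : List A :=
  (List.range n).map fun j => X (i + j)

theorem length_le_of_nonerasing {ψ : FreeMonoid A →* FreeMonoid B} (h : IsNonerasing ψ)
    (u : List A) : u.length ≤ (ψ (FreeMonoid.ofList u)).toList.length := by
  induction u with
  | nil => simp
  | cons x u ih =>
    have h2 : 0 < (ψ (FreeMonoid.of x)).toList.length := by
      rw [List.length_pos_iff]
      intro h0
      exact h x h0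
    rw [FreeMonoid.ofList_cons, map_mul, FreeMonoid.toList_mul, List.length_append,
      List.length_cons]
    omega

theorem lt_length_map_factor {ψ : FreeMonoid A →* FreeMonoid B} (h : IsNonerasing ψ)
    (X : ℕ → A) (n : ℕ) :
    n < (ψ (FreeMonoid.ofList (factor X 0 (n + 1)))).toList.length :=
  lt_of_lt_of_le (by simp [factor]) (length_le_of_nonerasing h (factor X 0 (n + 1)))

/-- The image `ψ(X)` of an infinite word under a non-erasing morphism: the infinite word such that
`ψ(u)` is a prefix of `ψ(X)` for every prefix `u` of `X`. Its letter number `n` is read in the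
image of the prefix of length `n + 1` of `X`. -/
def mapInfinite (ψ : FreeMonoid A →* FreeMonoid B) (h : IsNonerasing ψ) (X : ℕ → A) : ℕ → B :=
  fun n => (ψ (FreeMonoid.ofList (factor X 0 (n + 1)))).toList[n]'(lt_length_map_factor h X n)

/-- The finite word `u` is a subword of the infinite word `X`. -/
def IsFactor (u : List A) (X : ℕ → A) : Prop :=
  ∃ i : ℕ, factor X i u.length = u

/-- `X` is uniformly recurrent: for each finite subword `u` of `X` there is `N` such that `u` occurs
in every subword of `X` of length `N`. -/
def IsUniformlyRecurrent (X : ℕ → A) : Prop :=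
  ∀ u : List A, IsFactor u X →
    ∃ N : ℕ, ∀ v : List A, IsFactor v X → v.length = N → u <:+: v

/-- `X` is (purely) periodic: `X = u u u ⋯` for some nonempty finite word `u`. -/
def IsPeriodic (X : ℕ → A) : Prop :=
  ∃ p : ℕ, 0 < p ∧ ∀ n : ℕ, X (n + p) = X n

/-- The word `w` is `φ`-bounded: the sequence `w, φ(w), φ²(w), …` is eventually periodic. -/
def IsBounded (φ : FreeMonoid A →* FreeMonoid A) (w : FreeMonoid A) : Prop :=
  ∃ p : ℕ, 0 < p ∧ ∃ N : ℕ, ∀ n : ℕ, N ≤ n → φ^[n + p] w = φ^[n] w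

/-- The word `w` is `φ`-growing: it is not `φ`-bounded. -/
def IsGrowing (φ : FreeMonoid A →* FreeMonoid A) (w : FreeMonoid A) : Prop :=
  ¬ IsBounded φ w

/-- The word `w` has growth order `(d, θ)` under `φ`: the quotient `|φⁿ(w)| / (n^d θⁿ)`, `n ≥ 1`, lies
between two positive constants. -/
def HasGrowthOrder (φ : FreeMonoid A →* FreeMonoid A) (w : FreeMonoid A) (d : ℕ) (θ : ℝ) : Prop :=
  0 < θ ∧ ∃ c C : ℝ, 0 < c ∧ 0 < C ∧ ∀ n : ℕ, 1 ≤ n →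
    c * ((n : ℝ) ^ d * θ ^ n) < ((φ^[n] w).length : ℝ) ∧
      ((φ^[n] w).length : ℝ) < C * ((n : ℝ) ^ d * θ ^ n)

/-- Comparison of growth orders: `(d₁, θ₁) ≤ (d₂, θ₂)` if `θ₁ < θ₂`, or `θ₁ = θ₂` and `d₁ ≤ d₂`. -/
def GrowthOrderLE (d₁ : ℕ) (θ₁ : ℝ) (d₂ : ℕ) (θ₂ : ℝ) : Prop :=
  θ₁ < θ₂ ∨ (θ₁ = θ₂ ∧ d₁ ≤ d₂)

/-- `(D, Θ)` is the greatest of the growth orders of the letters. -/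
def IsMaxGrowthOrder (φ : FreeMonoid A →* FreeMonoid A) (D : ℕ) (Θ : ℝ) : Prop :=
  (∃ a : A, HasGrowthOrder φ (FreeMonoid.of a) D Θ) ∧
    ∀ (a : A) (d : ℕ) (θ : ℝ), HasGrowthOrder φ (FreeMonoid.of a) d θ → GrowthOrderLE d θ D Θ

end MorphicWord

/-!
The idea is to compare all letters with a letter `e` of slowest growth, and to show that a letter of
faster growth would create too many factors in `W`.

Write `|φⁿ(a)|` for the growth of a letter `a`. A terminal letter, that is, one which is reached
from all letters that it reaches, has a growth that is multiplicative up to constants, hence of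
exact order `θⁿ` (`IsTerminal.exists_growth_bounds`), and `θ > 1` since the letter is growing. Every
letter reaches a terminal one, so for a terminal letter `e` with the smallest `θ` every letter grows
at least like `θⁿ` (`exists_isTerminal_minimal_growth`). It remains to show that every letter is
slow, that is, that it grows at most like `θⁿ`.

Since `W` is uniformly recurrent, all its factors occur in the words `ψ(φᵐ(e))`. These are built
from blocks `ψ(φⁿ(z))` whose lengths, for fixed `n`, are comparable, and this makes `W` linearly
recurrent (`exists_isLinearlyRecurrent`). In a linearly recurrent word which is not periodic a long
word has no relatively small period and the number of factors grows linearly, so two given words of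
length `L` follow each other at a bounded number of distances that are small with respect to `L`
(`IsLinearlyRecurrent.card_gaps_le`).

If some letter is fast, then fast letters occur arbitrarily far in the fixed point of `φ`, and the
slow words `φᵏ(e)` lie between them. This gives infinitely many factors `C w D` with the same fast
letters `C`, `D` and slow words `w` such that the lengths `|ψ(φⁿ(w))|` are distinct for every
`n`. For large `n` these lengths are small compared with those of `φⁿ(C)` and `φⁿ(D)`, which
contradicts the bound on the number of distances (`isSlow_of_isLinearlyRecurrent`).
-/

namespace MorphicWord

/-! ### Lengths of images and iterates -/

section Words

variable {A B C : Type*}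

theorem toList_map (h : FreeMonoid A →* FreeMonoid B) (w : FreeMonoid A) :
    (h w).toList = w.toList.flatMap fun a => (h (FreeMonoid.of a)).toList := by
  induction w using FreeMonoid.recOn with
  | one => simp
  | of_mul x xs ih => simp [map_mul, FreeMonoid.toList_mul, ih]

theorem length_map_eq_sum (h : FreeMonoid A →* FreeMonoid B) (w : FreeMonoid A) :
    (h w).length = (w.toList.map fun a => (h (FreeMonoid.of a)).length).sum := by
  change (h w).toList.length = _
  rw [toList_map, List.length_flatMap]
  rfl

/-- A comparison of the lengths of the images of letters passes to words. -/
theorem length_map_le_mul {h : FreeMonoid A →* FreeMonoid B} {h' : FreeMonoid A →* FreeMonoid C}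
    {c : ℝ} {w : FreeMonoid A}
    (H : ∀ a ∈ w.toList, ((h (FreeMonoid.of a)).length : ℝ) ≤ c * (h' (FreeMonoid.of a)).length) :
    ((h w).length : ℝ) ≤ c * (h' w).length := by
  induction w using FreeMonoid.recOn with
  | one => simp
  | of_mul x xs ih =>
    have h1 := H x (by simp)
    have h2 := ih fun a ha => H a (by simp [ha])
    simp only [map_mul, FreeMonoid.length_mul]
    push_cast
    linarith

theorem length_map_le_of_letters {h : FreeMonoid A →* FreeMonoid B} {c : ℝ} {w : FreeMonoid A}
    (H : ∀ a ∈ w.toList, ((h (FreeMonoid.of a)).length : ℝ) ≤ c) :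
    ((h w).length : ℝ) ≤ c * w.length :=
  length_map_le_mul (h' := MonoidHom.id _) fun a ha => by simpa using H a ha

theorem mul_length_le_of_letters {h : FreeMonoid A →* FreeMonoid B} {c : ℝ} {w : FreeMonoid A}
    (hc : 0 < c) (H : ∀ a ∈ w.toList, c ≤ ((h (FreeMonoid.of a)).length : ℝ)) :
    c * w.length ≤ ((h w).length : ℝ) := by
  have := length_map_le_mul (h := MonoidHom.id _) (h' := h) (c := c⁻¹) (w := w) fun a ha => by
    have := H a ha
    rw [inv_mul_eq_div, le_div_iff₀ hc]
    simpa using this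
  rw [inv_mul_eq_div, le_div_iff₀ hc] at this
  simpa [mul_comm] using this

theorem length_of_mem_le (h : FreeMonoid A →* FreeMonoid B) {w : FreeMonoid A} {a : A}
    (ha : a ∈ w.toList) : (h (FreeMonoid.of a)).length ≤ (h w).length := by
  rw [length_map_eq_sum h w]
  exact List.single_le_sum (by simp) _ (List.mem_map.2 ⟨a, ha, rfl⟩)

theorem mem_map_of_mem {h : FreeMonoid A →* FreeMonoid B} {w : FreeMonoid A} {a : A} {b : B}
    (ha : a ∈ w.toList) (hb : b ∈ (h (FreeMonoid.of a)).toList) : b ∈ (h w).toList := by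
  rw [toList_map]
  exact List.mem_flatMap.2 ⟨a, ha, hb⟩

theorem exists_length_map_le [Finite A] (h : FreeMonoid A →* FreeMonoid B) :
    ∃ c : ℝ, 1 ≤ c ∧ ∀ w, ((h w).length : ℝ) ≤ c * w.length := by
  obtain ⟨M, hM⟩ := Finite.exists_le fun a => (h (FreeMonoid.of a)).length
  refine ⟨M + 1, by simp, fun w => length_map_le_of_letters fun a _ => ?_⟩
  have : ((h (FreeMonoid.of a)).length : ℝ) ≤ M := by exact_mod_cast hM a
  linarith

theorem IsNonerasing.length_le {h : FreeMonoid A →* FreeMonoid B} (hh : IsNonerasing h)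
    (w : FreeMonoid A) : w.length ≤ (h w).length :=
  length_le_of_nonerasing hh w.toList

theorem infix_map {h : FreeMonoid A →* FreeMonoid B} {u v : List A} (huv : u <:+: v) :
    (h (FreeMonoid.ofList u)).toList <:+: (h (FreeMonoid.ofList v)).toList := by
  obtain ⟨s, t, rfl⟩ := huv
  exact ⟨(h (FreeMonoid.ofList s)).toList, (h (FreeMonoid.ofList t)).toList, by
    simp [FreeMonoid.ofList_append, FreeMonoid.toList_mul]⟩

/-- The iterate `φⁿ` as a morphism. -/
def iter (φ : FreeMonoid A →* FreeMonoid A) : ℕ → FreeMonoid A →* FreeMonoid A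
  | 0 => MonoidHom.id _
  | n + 1 => (iter φ n).comp φ

variable {φ : FreeMonoid A →* FreeMonoid A}

theorem iter_apply (n : ℕ) (w : FreeMonoid A) : iter φ n w = φ^[n] w := by
  induction n generalizing w with
  | zero => rfl
  | succ n ih => exact ih _

theorem iter_add (m n : ℕ) (w : FreeMonoid A) : iter φ (m + n) w = iter φ m (iter φ n w) := by
  simp only [iter_apply, Function.iterate_add_apply]

theorem iter_succ' (n : ℕ) (w : FreeMonoid A) : iter φ (n + 1) w = φ (iter φ n w) := by
  simp only [iter_apply, Function.iterate_succ_apply']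

theorem iter_iter (p n : ℕ) (w : FreeMonoid A) : iter (iter φ p) n w = iter φ (p * n) w := by
  rw [iter_apply, iter_apply, Function.iterate_mul]
  congr 1
  funext x
  exact iter_apply p x

/-- The length of `φⁿ(a)`. -/
def growth (φ : FreeMonoid A →* FreeMonoid A) (a : A) (n : ℕ) : ℕ :=
  (iter φ n (FreeMonoid.of a)).length

theorem growth_zero (a : A) : growth φ a 0 = 1 := rfl

theorem IsNonerasing.iter (hφ : IsNonerasing φ) (n : ℕ) : IsNonerasing (iter φ n) := by
  intro a h
  have : 1 ≤ (MorphicWord.iter φ n (FreeMonoid.of a)).length := by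
    induction n with
    | zero => exact le_rfl
    | succ n ih =>
      rw [iter_succ']
      by_cases h0 : MorphicWord.iter φ n (FreeMonoid.of a) = 1
      · exact (ih h0).trans (hφ.length_le _)
      · refine le_trans ?_ (hφ.length_le _)
        exact Nat.one_le_iff_ne_zero.2 fun h => h0 (FreeMonoid.length_eq_zero.1 h)
  rw [h] at this
  simp at this

theorem growth_mono (hφ : IsNonerasing φ) (a : A) : Monotone (growth φ a) :=
  monotone_nat_of_le_succ fun n => by
    unfold growth
    rw [iter_succ']
    exact hφ.length_le _

theorem one_le_growth (hφ : IsNonerasing φ) (a : A) (n : ℕ) : 1 ≤ growth φ a n :=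
  growth_mono hφ a (Nat.zero_le n)

theorem growth_le_of_mem {a b : A} {k : ℕ} (h : b ∈ (iter φ k (FreeMonoid.of a)).toList) (n : ℕ) :
    growth φ b n ≤ growth φ a (n + k) := by
  unfold growth
  rw [iter_add]
  exact length_of_mem_le _ h

theorem growth_add_le {c : ℝ} (hc : ∀ w, ((φ w).length : ℝ) ≤ c * w.length) (h0 : 0 ≤ c)
    (a : A) (n k : ℕ) : (growth φ a (n + k) : ℝ) ≤ c ^ k * growth φ a n := by
  induction k with
  | zero => simp
  | succ k ih =>
    have : (growth φ a (n + (k + 1)) : ℝ) ≤ c * growth φ a (n + k) := by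
      unfold growth
      rw [← add_assoc, iter_succ']
      exact hc _
    calc _ ≤ _ := this
      _ ≤ c * (c ^ k * growth φ a n) := by gcongr
      _ = _ := by ring

theorem nonerasing_of_growing (h : ∀ a : A, IsGrowing φ (FreeMonoid.of a)) : IsNonerasing φ := by
  intro a ha
  have h1 : ∀ n, φ^[n + 1] (FreeMonoid.of a) = 1 := fun n => by
    rw [Function.iterate_succ_apply, ha, ← iter_apply, map_one]
  refine h a ⟨1, one_pos, 1, fun n hn => ?_⟩
  obtain ⟨m, rfl⟩ := Nat.exists_eq_add_of_le' hn
  rw [h1, h1]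

/-- Over a finite alphabet, the iterates of a growing letter have unbounded lengths: otherwise two
of them coincide. -/
theorem exists_lt_growth [Finite A] {a : A} (h : IsGrowing φ (FreeMonoid.of a)) (M : ℕ) :
    ∃ n, M < growth φ a n := by
  by_contra! hM
  have hfin : {l : List A | l.length ≤ M}.Finite := List.finite_length_le A M
  obtain ⟨m, -, n, -, hmn, he⟩ := Set.infinite_univ.exists_lt_map_eq_of_mapsTo
    (f := fun n => (iter φ n (FreeMonoid.of a)).toList) (fun n _ => hM n) hfin
  have he' : φ^[m] (FreeMonoid.of a) = φ^[n] (FreeMonoid.of a) := by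
    rw [← iter_apply, ← iter_apply]
    exact he
  refine h ⟨n - m, by omega, m, fun k hk => ?_⟩
  have h1 : k + (n - m) = (k - m) + n := by omega
  rw [h1, Function.iterate_add_apply, ← he', ← Function.iterate_add_apply]
  congr 2
  omega

end Words

/-! ### Images of infinite words -/

section Infinite

variable {A B C : Type*}

@[simp]
theorem length_factor (X : ℕ → A) (i n : ℕ) : (factor X i n).length = n := by simp [factor]

theorem factor_add (X : ℕ → A) (i m n : ℕ) :
    factor X i (m + n) = factor X i m ++ factor X (i + m) n := by
  simp [factor, List.range_add, add_assoc]

@[simp]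
theorem getElem_factor (X : ℕ → A) (i n k : ℕ) (hk : k < (factor X i n).length) :
    (factor X i n)[k] = X (i + k) := by simp [factor]

theorem eq_factor_iff {X : ℕ → A} {i : ℕ} {l : List A} :
    factor X i l.length = l ↔ ∀ k (hk : k < l.length), l[k] = X (i + k) := by
  constructor
  · intro h k hk
    have : (factor X i l.length)[k]'(by simpa using hk) = X (i + k) := by simp
    rw [← this]
    congr 1
    exact h.symm
  · intro h
    refine List.ext_getElem (by simp) fun k h1 h2 => ?_
    rw [getElem_factor, h k h2]

theorem factor_of_infix {X : ℕ → A} {u v : List A} (huv : u <:+: v) {i : ℕ}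
    (h : factor X i v.length = v) : ∃ s, s + u.length ≤ v.length ∧
      factor X (i + s) u.length = u := by
  obtain ⟨s, t, rfl⟩ := huv
  refine ⟨s.length, by simp, ?_⟩
  rw [List.length_append, List.length_append, factor_add, factor_add] at h
  exact (List.append_inj (List.append_inj h (by simp)).1 (by simp)).2

theorem IsFactor.of_infix {X : ℕ → A} {u v : List A} (huv : u <:+: v) (h : IsFactor v X) :
    IsFactor u X := by
  obtain ⟨i, hi⟩ := h
  obtain ⟨s, -, hs⟩ := factor_of_infix huv hi
  exact ⟨_, hs⟩

theorem isFactor_factor (X : ℕ → A) (i n : ℕ) : IsFactor (factor X i n) X :=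
  ⟨i, by simp⟩

/-- The infinite word `Y` starts with `h(u)` for each prefix `u` of the infinite word `X`; for a
non-erasing morphism `h` this says `Y = h(X)`. -/
def IsImage (h : FreeMonoid A →* FreeMonoid B) (X : ℕ → A) (Y : ℕ → B) : Prop :=
  ∀ n, factor Y 0 (h (FreeMonoid.ofList (factor X 0 n))).toList.length =
    (h (FreeMonoid.ofList (factor X 0 n))).toList

theorem IsImage.map_factor {h : FreeMonoid A →* FreeMonoid B} {X : ℕ → A} {Y : ℕ → B}
    (H : IsImage h X Y) (i n : ℕ) :
    factor Y (h (FreeMonoid.ofList (factor X 0 i))).length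
      (h (FreeMonoid.ofList (factor X i n))).toList.length =
      (h (FreeMonoid.ofList (factor X i n))).toList := by
  have h1 := H (i + n)
  rw [factor_add, FreeMonoid.ofList_append, map_mul, FreeMonoid.toList_mul, List.length_append,
    factor_add, Nat.zero_add] at h1
  have h2 := (List.append_inj h1 (by simp)).2
  rw [Nat.zero_add] at h2
  exact h2

theorem IsImage.isFactor {h : FreeMonoid A →* FreeMonoid B} {X : ℕ → A} {Y : ℕ → B}
    (H : IsImage h X Y) {u : List A} (hu : IsFactor u X) :
    IsFactor (h (FreeMonoid.ofList u)).toList Y := by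
  obtain ⟨i, hi⟩ := hu
  have := H.map_factor i u.length
  rw [hi] at this
  exact ⟨_, this⟩

theorem IsImage.comp {h : FreeMonoid A →* FreeMonoid B} {g : FreeMonoid B →* FreeMonoid C}
    {X : ℕ → A} {Y : ℕ → B} {Z : ℕ → C} (H : IsImage h X Y) (G : IsImage g Y Z) :
    IsImage (g.comp h) X Z := by
  intro n
  have h1 := H n
  have h2 := G (h (FreeMonoid.ofList (factor X 0 n))).toList.length
  rw [h1] at h2
  exact h2

theorem IsImage.iter {φ : FreeMonoid A →* FreeMonoid A} {X : ℕ → A} (H : IsImage φ X X) (n : ℕ) :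
    IsImage (iter φ n) X X := by
  induction n with
  | zero =>
    intro n
    change factor X 0 (factor X 0 n).length = factor X 0 n
    simp
  | succ n ih => exact H.comp ih

theorem isImage_mapInfinite {ψ : FreeMonoid A →* FreeMonoid B} (hψ : IsNonerasing ψ)
    (X : ℕ → A) : IsImage ψ X (mapInfinite ψ hψ X) := by
  have hpre : ∀ m n, m ≤ n → (ψ (FreeMonoid.ofList (factor X 0 m))).toList <+:
      (ψ (FreeMonoid.ofList (factor X 0 n))).toList := by
    intro m n hmn
    obtain ⟨d, rfl⟩ := Nat.exists_eq_add_of_le hmn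
    rw [factor_add, FreeMonoid.ofList_append, map_mul, FreeMonoid.toList_mul]
    exact List.prefix_append _ _
  intro n
  rw [eq_factor_iff]
  intro k hk
  rw [Nat.zero_add]
  unfold mapInfinite
  rcases le_total n (k + 1) with h | h
  · exact (hpre _ _ h).getElem hk
  · exact ((hpre _ _ h).getElem (lt_length_map_factor hψ X k)).symm

theorem factor_infiniteIterate {φ : FreeMonoid A →* FreeMonoid A} {a : A}
    (h : IsProlongable φ a) (n : ℕ) :
    factor (infiniteIterate φ a h) 0 (φ^[n] (FreeMonoid.of a)).toList.length =
      (φ^[n] (FreeMonoid.of a)).toList := by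
  have hpre : ∀ m n, m ≤ n → (φ^[m] (FreeMonoid.of a)).toList <+:
      (φ^[n] (FreeMonoid.of a)).toList := by
    intro m n hmn
    induction n, hmn using Nat.le_induction with
    | base => exact List.prefix_rfl
    | succ n _ ih =>
      obtain ⟨v, hv, -⟩ := h
      refine ih.trans ?_
      rw [Function.iterate_succ_apply, hv, iterate_map_mul, FreeMonoid.toList_mul]
      exact List.prefix_append _ _
  rw [eq_factor_iff]
  intro k hk
  rw [Nat.zero_add]
  unfold infiniteIterate
  rcases le_total n k with h' | h'
  · exact (hpre _ _ h').getElem hk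
  · exact ((hpre _ _ h').getElem (lt_length_iterate h k)).symm

theorem isImage_infiniteIterate {φ : FreeMonoid A →* FreeMonoid A} {a : A}
    (h : IsProlongable φ a) :
    IsImage φ (infiniteIterate φ a h) (infiniteIterate φ a h) := by
  intro n
  set X := infiniteIterate φ a h
  have h1 := factor_infiniteIterate h n
  have h2 := factor_infiniteIterate h (n + 1)
  obtain ⟨d, hd⟩ := Nat.exists_eq_add_of_lt (lt_length_iterate h n)
  rw [hd, add_assoc, factor_add, Nat.zero_add] at h1
  have h3 : φ^[n] (FreeMonoid.of a) = FreeMonoid.ofList (factor X 0 n ++ factor X n (d + 1)) := by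
    rw [h1]; rfl
  rw [Function.iterate_succ_apply', h3, FreeMonoid.ofList_append, map_mul,
    FreeMonoid.toList_mul] at h2
  rw [List.length_append, factor_add] at h2
  exact (List.append_inj h2 (by simp)).1

end Infinite

/-! ### Growth of letters -/

section Growth

variable {A B : Type*} {φ : FreeMonoid A →* FreeMonoid A}

/-- The letter `b` occurs in `φᵗ(a)` for some `t`. -/
def Reaches (φ : FreeMonoid A →* FreeMonoid A) (a b : A) : Prop :=
  ∃ t, b ∈ (iter φ t (FreeMonoid.of a)).toList

theorem Reaches.refl (a : A) : Reaches φ a a := ⟨0, by simp [iter]⟩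

theorem mem_iter_add {a b c : A} {s t : ℕ} (hab : b ∈ (iter φ s (FreeMonoid.of a)).toList)
    (hbc : c ∈ (iter φ t (FreeMonoid.of b)).toList) :
    c ∈ (iter φ (t + s) (FreeMonoid.of a)).toList := by
  rw [iter_add]
  exact mem_map_of_mem hab hbc

theorem Reaches.trans {a b c : A} (hab : Reaches φ a b) (hbc : Reaches φ b c) : Reaches φ a c := by
  obtain ⟨s, hs⟩ := hab
  obtain ⟨t, ht⟩ := hbc
  exact ⟨_, mem_iter_add hs ht⟩

/-- The letter `e` is reached from all letters that it reaches: it belongs to a terminal strongly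
connected component of the graph of the relation `Reaches φ`. -/
def IsTerminal (φ : FreeMonoid A →* FreeMonoid A) (e : A) : Prop :=
  ∀ b, Reaches φ e b → Reaches φ b e

theorem exists_reaches_isTerminal [Finite A] (a : A) : ∃ e, Reaches φ a e ∧ IsTerminal φ e := by
  obtain ⟨e, he, hmin⟩ := Set.exists_min_image {b | Reaches φ a b}
    (fun b => {c | Reaches φ b c}.ncard) (Set.toFinite _) ⟨a, Reaches.refl a⟩
  refine ⟨e, he, fun b hb => ?_⟩
  have h1 : {c | Reaches φ b c} ⊆ {c | Reaches φ e c} := fun c hc => hb.trans hc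
  have h2 := Set.eq_of_subset_of_ncard_le h1 (hmin b (Reaches.trans he hb)) (Set.toFinite _)
  have h3 : e ∈ {c | Reaches φ e c} := Reaches.refl e
  rwa [← h2] at h3

theorem Reaches.growth_le [Finite A] {a b : A} (h : Reaches φ a b) :
    ∃ R : ℝ, 1 ≤ R ∧ ∀ n, (growth φ b n : ℝ) ≤ R * growth φ a n := by
  obtain ⟨t, ht⟩ := h
  obtain ⟨c, hc1, hc⟩ := exists_length_map_le φ
  refine ⟨c ^ t, one_le_pow₀ hc1, fun n => ?_⟩
  refine le_trans ?_ (growth_add_le hc (by linarith) a n t)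
  exact_mod_cast growth_le_of_mem ht n

/-- The letters of a terminal component have the same growth, up to a constant factor. -/
theorem IsTerminal.growth_comparable [Finite A] {e : A} (he : IsTerminal φ e) :
    ∃ R : ℝ, 1 ≤ R ∧ ∀ b, Reaches φ e b → ∀ n,
      (growth φ e n : ℝ) ≤ R * growth φ b n ∧ (growth φ b n : ℝ) ≤ R * growth φ e n := by
  have h : ∀ b, ∃ R : ℝ, 1 ≤ R ∧ (Reaches φ e b → ∀ n,
      (growth φ e n : ℝ) ≤ R * growth φ b n ∧ (growth φ b n : ℝ) ≤ R * growth φ e n) := by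
    intro b
    by_cases hb : Reaches φ e b
    · obtain ⟨R₁, h1, H1⟩ := hb.growth_le
      obtain ⟨R₂, h2, H2⟩ := (he b hb).growth_le
      refine ⟨max R₁ R₂, le_max_of_le_left h1, fun _ n => ⟨(H2 n).trans ?_, (H1 n).trans ?_⟩⟩
      · gcongr
        exact le_max_right _ _
      · gcongr
        exact le_max_left _ _
    · exact ⟨1, le_rfl, fun h => absurd h hb⟩
  choose R hR1 hR using h
  obtain ⟨M, hM⟩ := Finite.exists_le R
  refine ⟨M, (hR1 e).trans (hM e), fun b hb n => ⟨(hR b hb n).1.trans ?_, (hR b hb n).2.trans ?_⟩⟩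
  · gcongr
    exact hM b
  · gcongr
    exact hM b

/-- A sequence that is multiplicative up to a constant factor is geometric up to a constant
factor. -/
theorem exists_geometric_bounds {f : ℕ → ℝ} {R : ℝ} (hR : 1 ≤ R) (h0 : f 0 = 1)
    (hf : ∀ n, 1 ≤ f n) (hle : ∀ m n, f (m + n) ≤ R * (f m * f n))
    (hge : ∀ m n, f m * f n ≤ R * f (m + n)) :
    ∃ θ : ℝ, 0 < θ ∧ ∀ n, θ ^ n ≤ R * f n ∧ f n ≤ R * θ ^ n := by
  have hR0 : 0 < R := by linarith
  have hf0 : ∀ n, 0 < f n := fun n => by linarith [hf n]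
  have hup : ∀ m k, R * f (m * k) ≤ (R * f m) ^ k * R := by
    intro m k
    induction k with
    | zero => simp [h0]
    | succ k ih =>
      calc R * f (m * (k + 1)) ≤ R * (R * (f (m * k) * f m)) := by
            rw [Nat.mul_succ]; gcongr; exact hle _ _
        _ = (R * f (m * k)) * (R * f m) := by ring
        _ ≤ ((R * f m) ^ k * R) * (R * f m) := by
            gcongr; exact mul_nonneg hR0.le (hf0 m).le
        _ = _ := by ring
  have hlow : ∀ m k, (f m / R) ^ k ≤ f (m * k) := by
    intro m k
    induction k with
    | zero => simp [h0]
    | succ k ih =>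
      calc (f m / R) ^ (k + 1) = (f m / R) ^ k * (f m / R) := pow_succ _ _
        _ ≤ f (m * k) * (f m / R) := by
            gcongr; exact div_nonneg (hf0 m).le hR0.le
        _ = (f (m * k) * f m) / R := by ring
        _ ≤ f (m * (k + 1)) := by
            rw [div_le_iff₀ hR0, mul_comm, Nat.mul_succ, mul_comm _ R]
            rw [mul_comm]
            exact hge _ _
  have hlog : ∀ n m : ℕ, 0 < n → 0 < m →
      Real.log (f n / R) / n ≤ Real.log (R * f m) / m := by
    intro n m hn hm
    have h1 : (f n / R) ^ m ≤ (R * f m) ^ n := by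
      have h2 := hup m n
      have h3 := hlow n m
      rw [mul_comm n m] at h3
      have h4 : f (m * n) ≤ (R * f m) ^ n := by
        rw [mul_comm] at h2
        exact le_of_mul_le_mul_right h2 hR0
      exact h3.trans h4
    have h2 := Real.log_le_log (pow_pos (div_pos (hf0 n) hR0) m) h1
    rw [Real.log_pow, Real.log_pow] at h2
    rw [div_le_div_iff₀ (by exact_mod_cast hn) (by exact_mod_cast hm)]
    linarith
  -- the logarithm of the ratio separates the two families of slopes compared in `hlog`
  set L := sSup ((fun n : ℕ => Real.log (f n / R) / n) '' Set.Ici 1) with hL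
  have hbdd : BddAbove ((fun n : ℕ => Real.log (f n / R) / n) '' Set.Ici 1) := by
    refine ⟨Real.log (R * f 1) / (1 : ℕ), ?_⟩
    rintro _ ⟨n, hn, rfl⟩
    exact hlog n 1 hn one_pos
  have hL1 : ∀ n : ℕ, 0 < n → Real.log (f n / R) / n ≤ L := fun n hn =>
    le_csSup hbdd ⟨n, hn, rfl⟩
  have hL2 : ∀ n : ℕ, 0 < n → L ≤ Real.log (R * f n) / n := by
    intro n hn
    refine csSup_le ⟨_, 1, le_refl 1, rfl⟩ ?_
    rintro _ ⟨m, hm, rfl⟩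
    exact hlog m n hm hn
  refine ⟨Real.exp L, Real.exp_pos L, fun n => ?_⟩
  rcases Nat.eq_zero_or_pos n with rfl | hn
  · simp [h0, hR]
  have hn' : (0 : ℝ) < n := by exact_mod_cast hn
  rw [← Real.exp_nat_mul]
  constructor
  · rw [← Real.le_log_iff_exp_le (mul_pos hR0 (hf0 n)), mul_comm, ← le_div_iff₀ hn']
    exact hL2 n hn
  · rw [mul_comm, ← div_le_iff₀ hR0, ← Real.log_le_iff_le_exp (div_pos (hf0 n) hR0), mul_comm,
      ← div_le_iff₀ hn']
    exact hL1 n hn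

/-- A terminal growing letter has purely exponential growth. -/
theorem IsTerminal.exists_growth_bounds [Finite A]
    (hgrow : ∀ a : A, IsGrowing φ (FreeMonoid.of a)) {e : A} (he : IsTerminal φ e) :
    ∃ θ : ℝ, 1 < θ ∧ ∃ R : ℝ, 0 < R ∧
      ∀ n, θ ^ n ≤ R * growth φ e n ∧ (growth φ e n : ℝ) ≤ R * θ ^ n := by
  have hφ := nonerasing_of_growing hgrow
  obtain ⟨R, hR1, hR⟩ := he.growth_comparable
  have hR0 : 0 < R := by linarith
  have hmul : ∀ m n, (growth φ e (m + n) : ℝ) ≤ R * (growth φ e m * growth φ e n) ∧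
      (growth φ e m * growth φ e n : ℝ) ≤ R * growth φ e (m + n) := by
    intro m n
    unfold growth
    rw [iter_add]
    constructor
    · rw [← mul_assoc]
      exact length_map_le_of_letters fun a ha => (hR a ⟨n, ha⟩ m).2
    · have := mul_length_le_of_letters (h := iter φ m) (c := growth φ e m / R)
        (w := iter φ n (FreeMonoid.of e))
        (div_pos (by exact_mod_cast one_le_growth hφ e m) hR0) fun a ha => by
          rw [div_le_iff₀ hR0, mul_comm]
          exact (hR a ⟨n, ha⟩ m).1
      rw [div_mul_eq_mul_div, div_le_iff₀ hR0, mul_comm _ R] at this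
      exact this
  obtain ⟨θ, hθ0, hθ⟩ := exists_geometric_bounds (f := fun n => (growth φ e n : ℝ)) hR1
    (by simp [growth_zero]) (fun n => by exact_mod_cast one_le_growth hφ e n)
    (fun m n => (hmul m n).1) (fun m n => (hmul m n).2)
  refine ⟨θ, ?_, R, hR0, hθ⟩
  by_contra! h
  obtain ⟨M, hM⟩ := exists_nat_gt R
  obtain ⟨n, hn⟩ := exists_lt_growth (hgrow e) M
  have h1 : (growth φ e n : ℝ) ≤ R * 1 := (hθ n).2.trans (by gcongr; exact pow_le_one₀ hθ0.le h)
  have h2 : (M : ℝ) < growth φ e n := by exact_mod_cast hn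
  linarith

/-- Some terminal letter grows as slowly as any letter does. -/
theorem exists_isTerminal_minimal_growth [Finite A] [Nonempty A]
    (hgrow : ∀ a : A, IsGrowing φ (FreeMonoid.of a)) :
    ∃ e, IsTerminal φ e ∧ ∃ θ : ℝ, 1 < θ ∧ (∃ T : ℝ, ∀ n, (growth φ e n : ℝ) ≤ T * θ ^ n) ∧
      ∃ c : ℝ, 0 < c ∧ ∀ a n, c * θ ^ n ≤ (growth φ a n : ℝ) := by
  have hφ := nonerasing_of_growing hgrow
  have h : ∀ e, ∃ θ : ℝ, IsTerminal φ e → 1 < θ ∧ ∃ R : ℝ, 0 < R ∧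
      ∀ n, θ ^ n ≤ R * growth φ e n ∧ (growth φ e n : ℝ) ≤ R * θ ^ n := by
    intro e
    by_cases he : IsTerminal φ e
    · obtain ⟨θ, h⟩ := he.exists_growth_bounds hgrow
      exact ⟨θ, fun _ => h⟩
    · exact ⟨0, fun h => absurd h he⟩
  choose θ hθ using h
  obtain ⟨e₀, -, he₀⟩ := exists_reaches_isTerminal (φ := φ) (Classical.arbitrary A)
  obtain ⟨e, he, hmin⟩ := Set.exists_min_image {e | IsTerminal φ e} θ (Set.toFinite _) ⟨e₀, he₀⟩
  obtain ⟨h1, R, hR, hRe⟩ := hθ e he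
  refine ⟨e, he, θ e, h1, ⟨R, fun n => (hRe n).2⟩, ?_⟩
  have hlow : ∀ a, ∃ S : ℝ, 0 < S ∧ ∀ n, θ e ^ n ≤ S * growth φ a n := by
    intro a
    obtain ⟨e', hae, he'⟩ := exists_reaches_isTerminal (φ := φ) a
    obtain ⟨-, R', hR', hRe'⟩ := hθ e' he'
    obtain ⟨S, hS, hSa⟩ := hae.growth_le
    refine ⟨R' * S, mul_pos hR' (by linarith), fun n => ?_⟩
    calc θ e ^ n ≤ θ e' ^ n := by gcongr; exact hmin e' he'
      _ ≤ R' * growth φ e' n := (hRe' n).1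
      _ ≤ R' * (S * growth φ a n) := by gcongr; exact hSa n
      _ = _ := by ring
  choose S hS0 hS using hlow
  obtain ⟨M, hM⟩ := Finite.exists_le S
  have hM0 : 0 < M := (hS0 e).trans_le (hM e)
  refine ⟨M⁻¹, inv_pos.2 hM0, fun a n => ?_⟩
  rw [inv_mul_eq_div, div_le_iff₀ hM0, mul_comm]
  refine (hS a n).trans ?_
  gcongr
  exact hM a

end Growth

/-! ### Linearly recurrent words -/

section Recurrence

variable {B : Type*} {W : ℕ → B} {K : ℕ}

/-- Each factor of length `ℓ` of `W` occurs, for `ℓ ≥ 1`, in `W` at some position of any `K * ℓ`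
consecutive positions. -/
def IsLinearlyRecurrent (K : ℕ) (W : ℕ → B) : Prop :=
  ∀ l, 0 < l → ∀ i j, ∃ r < K * l, ∀ u < l, W (j + r + u) = W (i + u)

/-- A factor with period `q` of length `K (q + 1) + q` contains all factors of length `q + 1`, so
that `q` is a period of the infinite word. -/
theorem IsLinearlyRecurrent.isPeriodic (hW : IsLinearlyRecurrent K W) {a q : ℕ} (hq : 0 < q)
    (h : ∀ r < K * (q + 1), W (a + r) = W (a + r + q)) : IsPeriodic W := by
  refine ⟨q, hq, fun n => ?_⟩
  obtain ⟨r, hr, hru⟩ := hW (q + 1) q.succ_pos n a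
  rw [← hru q (by omega), ← h r hr]
  simpa using hru 0 q.succ_pos

/-- In a nonperiodic linearly recurrent word, two long words occur at a bounded number of
relatively small distances from each other: the windows of length `2 (K + 1) τ` which start at a
distance less than `τ` from the first letter of one of the given occurrences are pairwise distinct,
and linear recurrence bounds the number of factors of this length. -/
theorem IsLinearlyRecurrent.card_gaps_le (hW : IsLinearlyRecurrent K W) (hper : ¬ IsPeriodic W)
    {M τ : ℕ} (hτ : 0 < τ) (s p : ℕ → B) (a x : Fin M → ℕ) (hx : ∀ j, x j < τ)
    (hinj : Function.Injective x)
    (hs : ∀ j, ∀ r < (K + 1) * τ, W (a j + r) = s r)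
    (hp : ∀ j, ∀ r < (K + 1) * τ, W (a j + (K + 1) * τ + x j + r) = p r) :
    M ≤ K * (2 * (K + 1)) := by
  have hnot : ∀ (b q : ℕ), 0 < q → q < τ → ¬ ∀ r < K * τ, W (b + r) = W (b + r + q) :=
    fun b q hq hqτ H => hper (hW.isPeriodic (a := b) hq fun r hr =>
      H r (hr.trans_le (Nat.mul_le_mul_left K hqτ)))
  obtain ⟨L, hL⟩ : ∃ L, L = (K + 1) * τ := ⟨_, rfl⟩
  rw [← hL] at hs hp
  have hL' : L = K * τ + τ := by rw [hL]; ring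
  have hτL : 0 < 2 * L := by omega
  choose f hf1 hf2 using fun jt : Fin M × Fin τ => hW (2 * L) hτL (a jt.1 + jt.2) 0
  have hf_inj : Function.Injective f := by
    have hword : ∀ jt kt, f jt = f kt → ∀ u < 2 * L,
        W (a jt.1 + jt.2 + u) = W (a kt.1 + kt.2 + u) := by
      intro jt kt h u hu
      rw [← hf2 jt u hu, ← hf2 kt u hu, h]
    have ht : ∀ jt kt, f jt = f kt → ¬ (jt.2 : ℕ) < kt.2 := by
      rintro ⟨j, t, ht⟩ ⟨k, t', ht'⟩ h hlt
      simp only at hlt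
      refine hnot (a j + t) (t' - t) (by omega) (by omega) fun r hr => ?_
      have h1 := hword _ _ h r (by omega)
      simp only at h1
      rw [h1, add_assoc, hs k _ (by omega)]
      have h2 : a j + t + r + (t' - t) = a j + (t' + r) := by omega
      rw [h2, hs j _ (by omega)]
    have hx' : ∀ jt kt, f jt = f kt → ¬ x jt.1 < x kt.1 := by
      intro jt kt h hlt
      have htt : (jt.2 : ℕ) = kt.2 := le_antisymm (not_lt.1 (ht _ _ h.symm)) (not_lt.1 (ht _ _ h))
      have hxk := hx kt.1
      have hjt := jt.2.2
      refine hnot (a jt.1 + L + x jt.1) (x kt.1 - x jt.1) (by omega) (by omega) fun r hr => ?_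
      have h1 := hword _ _ h (L - kt.2 + x kt.1 + r) (by omega)
      have h2 : a jt.1 + L + x jt.1 + r + (x kt.1 - x jt.1) =
        a jt.1 + jt.2 + (L - kt.2 + x kt.1 + r) := by omega
      have h3 : a kt.1 + kt.2 + (L - kt.2 + x kt.1 + r) = a kt.1 + L + x kt.1 + r := by omega
      rw [hp jt.1 r (by omega), h2, h1, h3, hp kt.1 r (by omega)]
    intro jt kt h
    refine Prod.ext (hinj ?_) (Fin.ext ?_)
    · exact le_antisymm (not_lt.1 (hx' _ _ h.symm)) (not_lt.1 (hx' _ _ h))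
    · exact le_antisymm (not_lt.1 (ht _ _ h.symm)) (not_lt.1 (ht _ _ h))
  have hcard := Fintype.card_le_of_injective
    (fun jt => (⟨f jt, hf1 jt⟩ : Fin (K * (2 * L)))) fun jt kt h => hf_inj (Fin.ext_iff.1 h)
  simp only [Fintype.card_prod, Fintype.card_fin] at hcard
  refine Nat.le_of_mul_le_mul_right (hcard.trans (le_of_eq ?_)) hτ
  rw [hL]; ring

end Recurrence

/-! ### Linear recurrence of uniformly recurrent morphic words -/

section LinearRecurrence

variable {A B : Type*}

/-- A word that is not longer than any of the blocks of a concatenation meets at most two of them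
in each of its occurrences. -/
theorem exists_infix_length_le_two {g : A → List B} {l : List A} {u : List B}
    (h : u <:+: l.flatMap g) (hl : ∀ a ∈ l, u.length ≤ (g a).length) :
    ∃ l', l' <:+: l ∧ l'.length ≤ 2 ∧ u <:+: l'.flatMap g := by
  induction l with
  | nil => exact ⟨[], List.infix_rfl, by simp, h⟩
  | cons a l ih =>
    obtain ⟨s, t, hst⟩ := h
    rw [List.flatMap_cons, List.append_assoc] at hst
    rcases le_total (g a).length s.length with h1 | h1
    · obtain ⟨s', rfl⟩ := List.prefix_of_prefix_length_le
        (List.prefix_append _ _) ⟨u ++ t, hst⟩ h1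
      rw [List.append_assoc, List.append_cancel_left_eq] at hst
      obtain ⟨l', h2, h3⟩ := ih ⟨s', t, by simpa using hst⟩ fun b hb => hl b (by simp [hb])
      exact ⟨l', h2.trans (List.suffix_cons a l).isInfix, h3⟩
    · rcases l with _ | ⟨b, l⟩
      · exact ⟨[a], List.infix_rfl, by simp, s, t, by simpa using hst⟩
      · have h2 := hl b (by simp)
        have h3 : s ++ u <+: g a ++ g b := by
          refine List.prefix_of_prefix_length_le (l₃ := g a ++ List.flatMap g (b :: l))
            ⟨t, by rw [List.append_assoc, hst]⟩
            ⟨l.flatMap g, by simp⟩ ?_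
          simp only [List.length_append]
          omega
        refine ⟨[a, b], ⟨[], l, by simp⟩, by simp, ?_⟩
        have h4 : [a, b].flatMap g = g a ++ g b := by simp
        rw [h4]
        exact (List.suffix_append s u).isInfix.trans h3.isInfix

/-- A word more than twice as long as the blocks of a concatenation contains a complete block in
each of its occurrences. -/
theorem exists_infix_of_two_mul_lt {g : A → List B} {M : ℕ} {l : List A} {v : List B}
    (h : v <:+: l.flatMap g) (hM : ∀ a ∈ l, (g a).length ≤ M) (hv : 2 * M < v.length) :
    ∃ a ∈ l, g a <:+: v := by
  induction l with
  | nil =>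
    have := h.length_le
    simp at this
    simp [this] at hv
  | cons a l ih =>
    obtain ⟨s, t, hst⟩ := h
    rw [List.flatMap_cons, List.append_assoc] at hst
    have hMa := hM a (by simp)
    rcases le_total (g a).length s.length with h1 | h1
    · obtain ⟨s', rfl⟩ := List.prefix_of_prefix_length_le
        (List.prefix_append _ _) ⟨v ++ t, hst⟩ h1
      rw [List.append_assoc, List.append_cancel_left_eq] at hst
      obtain ⟨b, hb, h2⟩ := ih ⟨s', t, by simpa using hst⟩ fun b hb => hM b (by simp [hb])
      exact ⟨b, by simp [hb], h2⟩
    · rcases l with _ | ⟨b, l⟩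
      · have := congrArg List.length hst
        simp only [List.length_append, List.flatMap_nil, List.length_nil] at this
        omega
      · have hMb := hM b (by simp)
        obtain ⟨s', hs'⟩ : s <+: g a :=
          List.prefix_of_prefix_length_le ⟨v ++ t, hst⟩ (List.prefix_append _ _) h1
        have hlen := congrArg List.length hs'
        rw [List.length_append] at hlen
        rw [← hs', List.append_assoc, List.append_cancel_left_eq] at hst
        have h3 : s' ++ g b <+: v := by
          refine List.prefix_of_prefix_length_le (l₃ := v ++ t) ?_ (List.prefix_append _ _) ?_
          · rw [hst]
            exact ⟨l.flatMap g, by simp⟩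
          · simp only [List.length_append]
            omega
        exact ⟨b, by simp, (List.suffix_append s' (g b)).isInfix.trans h3.isInfix⟩

variable {φ : FreeMonoid A →* FreeMonoid A}

theorem infix_iter_of_mem {a b : A} {w : List A} {s t : ℕ}
    (hb : b ∈ (iter φ s (FreeMonoid.of a)).toList)
    (hw : w <:+: (iter φ t (FreeMonoid.of b)).toList) :
    w <:+: (iter φ (t + s) (FreeMonoid.of a)).toList := by
  rw [iter_add]
  obtain ⟨x, y, hxy⟩ := List.append_of_mem hb
  have h1 : [b] <:+: (iter φ s (FreeMonoid.of a)).toList := ⟨x, y, by rw [hxy]; simp⟩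
  exact hw.trans (infix_map (h := iter φ t) h1)

theorem mem_iter_self {e : A} (hee : e ∈ (φ (FreeMonoid.of e)).toList) (k : ℕ) :
    e ∈ (iter φ k (FreeMonoid.of e)).toList := by
  induction k with
  | zero => simp [iter]
  | succ k ih => exact mem_iter_add (s := 1) hee ih

/-- If `e` occurs in `φ(e)`, then the words of length at most two that occur in the words `φᵗ(e)`
all occur in `φᴶ(z)`, for a single exponent `J` and all letters `z` that `e` reaches. -/
theorem IsTerminal.exists_uniform_exponent [Finite A] {e : A} (he : IsTerminal φ e)
    (hee : e ∈ (φ (FreeMonoid.of e)).toList) :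
    ∃ J, ∀ z, Reaches φ e z → ∀ w : List A, w.length ≤ 2 → ∀ t,
      w <:+: (iter φ t (FreeMonoid.of e)).toList →
        w <:+: (iter φ J (FreeMonoid.of z)).toList := by
  have h1 : ∀ z, ∃ k, Reaches φ e z → e ∈ (iter φ k (FreeMonoid.of z)).toList := by
    intro z
    by_cases hz : Reaches φ e z
    · obtain ⟨k, hk⟩ := he z hz
      exact ⟨k, fun _ => hk⟩
    · exact ⟨0, fun h => absurd h hz⟩
  have h2 : ∀ w : {w : List A | w.length ≤ 2}, ∃ k, ∀ t,
      w.1 <:+: (iter φ t (FreeMonoid.of e)).toList →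
        w.1 <:+: (iter φ k (FreeMonoid.of e)).toList := by
    intro w
    by_cases hw : ∃ t, w.1 <:+: (iter φ t (FreeMonoid.of e)).toList
    · obtain ⟨k, hk⟩ := hw
      exact ⟨k, fun _ _ => hk⟩
    · exact ⟨0, fun t ht => absurd ⟨t, ht⟩ hw⟩
  choose k hk using h1
  choose T hT using h2
  have : Finite {w : List A | w.length ≤ 2} := (List.finite_length_le A 2).to_subtype
  obtain ⟨k', hk'⟩ := Finite.exists_le k
  obtain ⟨T', hT'⟩ := Finite.exists_le T
  refine ⟨T' + k', fun z hz w hw t hwt => ?_⟩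
  have h3 : w <:+: (iter φ T' (FreeMonoid.of e)).toList := by
    have := infix_iter_of_mem (mem_iter_self hee (T' - T ⟨w, hw⟩)) (hT ⟨w, hw⟩ t hwt)
    rwa [Nat.add_sub_cancel' (hT' ⟨w, hw⟩)] at this
  have h4 : e ∈ (iter φ k' (FreeMonoid.of z)).toList := by
    have := mem_iter_add (hk z hz) (mem_iter_self hee (k' - k z))
    rwa [Nat.sub_add_cancel (hk' z)] at this
  exact infix_iter_of_mem h4 h3

/-- Uniform recurrence transfers every factor of `W` into the words `ψ(φᵐ(e))`, which are
concatenations of the blocks `ψ(φⁿ(z))`, where `z` is reached from `e`. All blocks with the same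
exponent `n` have comparable lengths, so a factor of length `ℓ` is covered by two neighbouring
blocks for a suitable `n`, and each pair of neighbours recurs in every block with an exponent larger
by a constant. -/
theorem exists_isLinearlyRecurrent_of_mem [Finite A] {ψ : FreeMonoid A →* FreeMonoid B}
    {X : ℕ → A} {W : ℕ → B} (hφ : IsNonerasing φ) (hψ : IsNonerasing ψ) (hX : IsImage φ X X)
    (hW : IsImage ψ X W) (hrec : IsUniformlyRecurrent W) {e : A} (heX : ∃ i, X i = e)
    (he : IsTerminal φ e) (hee : e ∈ (φ (FreeMonoid.of e)).toList)
    (hunb : ∀ M, ∃ n, M < growth φ e n) : ∃ K, IsLinearlyRecurrent K W := by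
  have hfac : ∀ u, IsFactor u W → ∃ m₀, ∀ m, m₀ ≤ m →
      u <:+: (ψ (iter φ m (FreeMonoid.of e))).toList := by
    intro u hu
    obtain ⟨N, hN⟩ := hrec u hu
    obtain ⟨m₀, hm₀⟩ := hunb N
    refine ⟨m₀, fun m hm => ?_⟩
    have h1 : N ≤ (ψ (iter φ m (FreeMonoid.of e))).toList.length :=
      (hm₀.le.trans (growth_mono hφ e hm)).trans (hψ.length_le _)
    have h2 : IsFactor (ψ (iter φ m (FreeMonoid.of e))).toList W := by
      obtain ⟨i, hi⟩ := heX
      exact hW.isFactor ((hX.iter m).isFactor (u := [e]) ⟨i, by simp [factor, hi]⟩)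
    have h3 := List.take_prefix N (ψ (iter φ m (FreeMonoid.of e))).toList
    exact (hN _ (h2.of_infix h3.isInfix) (by simpa using h1)).trans h3.isInfix
  obtain ⟨J, hJ⟩ := he.exists_uniform_exponent hee
  obtain ⟨R, hR1, hR⟩ := he.growth_comparable
  obtain ⟨c, hc1, hc⟩ := exists_length_map_le φ
  obtain ⟨d, hd1, hd⟩ := exists_length_map_le ψ
  have hR0 : 0 < R := by linarith
  have hc0 : 0 < c := by linarith
  have hd0 : 0 < d := by linarith
  set M := ⌈d * (R * (c ^ J * (c * R)))⌉₊ with hM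
  refine ⟨2 * M + 1, fun l hl i j => ?_⟩
  have hl' : (1 : ℝ) ≤ l := by exact_mod_cast hl
  -- the exponent `n` whose blocks have lengths between `l` and a constant multiple of `l`
  obtain ⟨n, hn1, hn2⟩ : ∃ n, R * l ≤ growth φ e n ∧ (growth φ e n : ℝ) ≤ c * R * l := by
    classical
    have hex : ∃ n, R * l ≤ (growth φ e n : ℝ) := by
      obtain ⟨N, hN⟩ := exists_nat_ge (R * l)
      obtain ⟨n, hn⟩ := hunb N
      exact ⟨n, hN.trans (by exact_mod_cast hn.le)⟩
    refine ⟨Nat.find hex, Nat.find_spec hex, ?_⟩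
    rcases h : Nat.find hex with _ | n
    · rw [growth_zero]
      have : 1 ≤ c * R := one_le_mul_of_one_le_of_one_le hc1 hR1
      have := one_le_mul_of_one_le_of_one_le this hl'
      simpa using this
    · have h1 := Nat.find_min hex (m := n) (by omega)
      have h2 := growth_add_le hc hc0.le e n 1
      rw [pow_one] at h2
      refine h2.trans ?_
      rw [mul_assoc]
      gcongr
      exact (not_le.1 h1).le
  obtain ⟨m₁, hm₁⟩ := hfac (factor W i l) (isFactor_factor W i l)
  obtain ⟨m₂, hm₂⟩ := hfac (factor W j ((2 * M + 1) * l)) (isFactor_factor W j _)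
  have hu := hm₁ (n + m₁) (by omega)
  have hv := hm₂ (n + J + m₂) (by omega)
  rw [iter_add] at hu hv
  rw [← MonoidHom.comp_apply, toList_map] at hu hv
  obtain ⟨w, hw1, hw2, hw3⟩ := exists_infix_length_le_two hu fun z hz => by
    rw [length_factor]
    have h1 := (hR z ⟨_, hz⟩ n).1
    have h2 : (l : ℝ) ≤ growth φ z n := le_of_mul_le_mul_left (hn1.trans h1) hR0
    have h3 : l ≤ growth φ z n := by exact_mod_cast h2
    exact h3.trans (hψ.length_le _)
  obtain ⟨z, hz, hzv⟩ := exists_infix_of_two_mul_lt (M := M * l) hv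
    (fun z hz => by
      have h1 : ((ψ (iter φ (n + J) (FreeMonoid.of z))).length : ℝ) ≤ (M * l : ℕ) := by
        calc ((ψ (iter φ (n + J) (FreeMonoid.of z))).length : ℝ)
            ≤ d * growth φ z (n + J) := hd _
          _ ≤ d * (R * growth φ e (n + J)) := by gcongr; exact (hR z ⟨_, hz⟩ _).2
          _ ≤ d * (R * (c ^ J * growth φ e n)) := by
              gcongr; exact growth_add_le hc hc0.le e n J
          _ ≤ d * (R * (c ^ J * (c * R * l))) := by gcongr
          _ = d * (R * (c ^ J * (c * R))) * l := by ring
          _ ≤ M * l := by gcongr; exact Nat.le_ceil _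
          _ = (M * l : ℕ) := by push_cast; ring
      exact_mod_cast h1)
    (by rw [length_factor]; nlinarith)
  have hwz := hJ z ⟨_, hz⟩ w hw2 _ hw1
  have h5 : factor W i l <:+: factor W j ((2 * M + 1) * l) := by
    refine (hw3.trans ?_).trans hzv
    have h6 := infix_map (h := ψ.comp (iter φ n)) hwz
    rw [toList_map (ψ.comp (iter φ n))] at h6
    refine h6.trans ?_
    rw [MonoidHom.comp_apply, MonoidHom.comp_apply, iter_add]
    exact List.infix_rfl
  obtain ⟨r, hr, hrw⟩ := factor_of_infix (X := W) h5 (i := j) (by simp)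
  simp only [length_factor] at hr hrw
  refine ⟨r, by omega, fun u hu => ?_⟩
  have h7 := congrArg (fun l : List B => l[u]?) hrw
  simpa [factor, hu] using h7

/-- A uniformly recurrent image of a fixed point of a morphism with growing letters is linearly
recurrent: a power of the morphism satisfies the hypothesis of
`exists_isLinearlyRecurrent_of_mem`. -/
theorem exists_isLinearlyRecurrent [Finite A] {ψ : FreeMonoid A →* FreeMonoid B}
    {X : ℕ → A} {W : ℕ → B} (hgrow : ∀ a : A, IsGrowing φ (FreeMonoid.of a))
    (hψ : IsNonerasing ψ) (hX : IsImage φ X X) (hW : IsImage ψ X W)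
    (hrec : IsUniformlyRecurrent W) {e : A} (heX : ∃ i, X i = e) (he : IsTerminal φ e) :
    ∃ K, IsLinearlyRecurrent K W := by
  have hφ := nonerasing_of_growing hgrow
  obtain ⟨p, hp, hep⟩ : ∃ p, 0 < p ∧ e ∈ (iter φ p (FreeMonoid.of e)).toList := by
    obtain ⟨b, hb⟩ := List.exists_mem_of_ne_nil (φ (FreeMonoid.of e)).toList
      fun h => hφ e (FreeMonoid.toList.injective h)
    obtain ⟨k, hk⟩ := he b ⟨1, hb⟩
    exact ⟨k + 1, k.succ_pos, mem_iter_add (s := 1) hb hk⟩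
  refine exists_isLinearlyRecurrent_of_mem (φ := iter φ p) (hφ.iter p) hψ (hX.iter p) hW hrec heX
    (fun b ⟨t, hb⟩ => ?_) hep fun M => ?_
  · rw [iter_iter] at hb
    obtain ⟨k, hk⟩ := he b ⟨_, hb⟩
    -- a return to `b` in `p * t + k` steps, repeated `p - 1` times, makes the time a multiple of `p`
    have hcycle : ∀ i, e ∈ (iter φ (i * (k + p * t) + k) (FreeMonoid.of b)).toList := by
      intro i
      induction i with
      | zero => simpa using hk
      | succ i ih =>
        have := mem_iter_add (mem_iter_add ih hb) hk
        have h1 : k + (p * t + (i * (k + p * t) + k)) = (i + 1) * (k + p * t) + k := by ring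
        rwa [h1] at this
    refine ⟨k + (p - 1) * t, ?_⟩
    rw [iter_iter]
    obtain ⟨q, rfl⟩ := Nat.exists_eq_add_of_lt hp
    have h1 : (0 + q + 1) * (k + (0 + q + 1 - 1) * t) = q * (k + (0 + q + 1) * t) + k := by
      rw [Nat.add_sub_cancel]
      ring
    rw [h1]
    exact hcycle q
  · obtain ⟨n, hn⟩ := exists_lt_growth (hgrow e) M
    refine ⟨n, hn.trans_le ?_⟩
    have h1 := growth_mono hφ e (Nat.le_mul_of_pos_left n hp)
    unfold growth at h1 ⊢
    rwa [iter_iter]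

end LinearRecurrence

/-! ### Slow and fast letters -/

section Slow

variable {A B : Type*} {φ : FreeMonoid A →* FreeMonoid A} {θ : ℝ}

/-- The lengths of the words `φⁿ(a)` are `O(θⁿ)`. Letters that are not slow are called fast. -/
def IsSlow (φ : FreeMonoid A →* FreeMonoid A) (θ : ℝ) (a : A) : Prop :=
  ∃ T : ℝ, ∀ n, (growth φ a n : ℝ) ≤ T * θ ^ n

theorem exists_length_iter_le [Finite A] (hθ : 0 < θ) {w : FreeMonoid A}
    (hw : ∀ a ∈ w.toList, IsSlow φ θ a) :
    ∃ T : ℝ, 0 < T ∧ ∀ n, ((iter φ n w).length : ℝ) ≤ T * θ ^ n := by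
  have h : ∀ a, ∃ T : ℝ, a ∈ w.toList → ∀ n, (growth φ a n : ℝ) ≤ T * θ ^ n := by
    intro a
    by_cases ha : a ∈ w.toList
    · obtain ⟨T, hT⟩ := hw a ha
      exact ⟨T, fun _ => hT⟩
    · exact ⟨0, fun h => absurd h ha⟩
  choose T hT using h
  obtain ⟨M, hM⟩ := Finite.exists_le T
  have hθn : ∀ n, 0 < θ ^ n := fun n => pow_pos hθ n
  refine ⟨max M 0 * w.length + 1, by positivity, fun n => ?_⟩
  have h1 : ((iter φ n w).length : ℝ) ≤ (max M 0 * θ ^ n) * w.length :=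
    length_map_le_of_letters fun a ha => (hT a ha n).trans (by
      have := hθn n
      gcongr
      exact (hM a).trans (le_max_left _ _))
  have := hθn n
  linarith

theorem IsSlow.of_reaches [Finite A] {a b : A} (ha : IsSlow φ θ a) (h : Reaches φ a b) :
    IsSlow φ θ b := by
  obtain ⟨T, hT⟩ := ha
  obtain ⟨R, hR1, hR⟩ := h.growth_le
  refine ⟨R * T, fun n => (hR n).trans ?_⟩
  rw [mul_assoc]
  gcongr
  exact hT n

theorem isSlow_of_image [Finite A] (hφ : IsNonerasing φ) (hθ : 0 < θ) {a : A}
    (h : ∀ b ∈ (φ (FreeMonoid.of a)).toList, IsSlow φ θ b) : IsSlow φ θ a := by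
  obtain ⟨T, -, hT⟩ := exists_length_iter_le hθ h
  refine ⟨T, fun n => le_trans ?_ (hT n)⟩
  exact_mod_cast growth_mono hφ a n.le_succ

/-- If `φ(a) = a v` and all letters of `v` are slow, then `|φⁿ(a)| = 1 + ∑_{k<n} |φᵏ(v)|` is
bounded by a geometric sum of ratio `θ > 1`. -/
theorem isSlow_of_eq_of_mul [Finite A] (hθ : 1 < θ) {a : A} {v : FreeMonoid A}
    (hv : φ (FreeMonoid.of a) = FreeMonoid.of a * v) (h : ∀ b ∈ v.toList, IsSlow φ θ b) :
    IsSlow φ θ a := by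
  obtain ⟨T, hT0, hT⟩ := exists_length_iter_le (by linarith) h
  have hθ' : 0 < θ - 1 := by linarith
  refine ⟨1 + T / (θ - 1), fun n => ?_⟩
  induction n with
  | zero =>
    rw [growth_zero]
    have := div_pos hT0 hθ'
    simp
    exact this.le
  | succ n ih =>
    have h1 : growth φ a (n + 1) = growth φ a n + (iter φ n v).length := by
      unfold growth
      rw [iter_add]
      change (iter φ n (φ (FreeMonoid.of a))).length = _
      rw [hv, map_mul, FreeMonoid.length_mul]
    have h2 := hT n
    have h3 : (1 + T / (θ - 1)) * θ ^ (n + 1) =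
        (1 + T / (θ - 1)) * θ ^ n + (θ - 1 + T) * θ ^ n := by
      field_simp
      ring
    have h4 : 0 < (θ - 1) * θ ^ n := by positivity
    rw [h1, h3]
    push_cast
    linarith

/-- The ratio `|φⁿ(a)| / θⁿ` of a letter that is not slow tends to infinity, since all letters grow
at least like `θⁿ`. -/
theorem exists_forall_le_growth {c : ℝ} (hθ : 0 < θ) (hc : 0 < c)
    (hlow : ∀ a n, c * θ ^ n ≤ (growth φ a n : ℝ)) {a : A} (ha : ¬ IsSlow φ θ a) (T : ℝ) :
    ∃ N, ∀ n, N ≤ n → T * θ ^ n ≤ growth φ a n := by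
  unfold IsSlow at ha
  push Not at ha
  obtain ⟨k, hk⟩ := ha (T / c)
  refine ⟨k, fun n hn => ?_⟩
  obtain ⟨m, rfl⟩ := Nat.exists_eq_add_of_le' hn
  have hθm : 0 < θ ^ m := pow_pos hθ m
  have h1 := mul_length_le_of_letters (h := iter φ m) (c := c * θ ^ m)
    (w := iter φ k (FreeMonoid.of a)) (by positivity) fun b _ => hlow b m
  rw [← iter_add] at h1
  refine le_trans ?_ h1
  calc T * θ ^ (m + k) = c * θ ^ m * (T / c * θ ^ k) := by
        field_simp
        ring
    _ ≤ c * θ ^ m * (iter φ k (FreeMonoid.of a)).length := by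
        gcongr
        exact hk.le

/-- If the first letter of the fixed point is fast, then fast letters occur arbitrarily far. -/
theorem exists_lt_not_isSlow [Finite A] {X : ℕ → A} (hφ : IsNonerasing φ) (hX : IsImage φ X X)
    (hpro : IsProlongable φ (X 0)) (hθ : 1 < θ) (h0 : ¬ IsSlow φ θ (X 0)) (n : ℕ) :
    ∃ i, n < i ∧ ¬ IsSlow φ θ (X i) := by
  obtain ⟨v, hv, hvk⟩ := hpro
  have hX1 : factor X 0 (φ (FreeMonoid.of (X 0))).toList.length =
      (φ (FreeMonoid.of (X 0))).toList := hX 1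
  have hv1 : 1 ≤ v.length := Nat.one_le_iff_ne_zero.2 fun h => hvk 0 (FreeMonoid.length_eq_zero.1 h)
  induction n with
  | zero =>
    by_contra! H
    refine h0 (isSlow_of_eq_of_mul hθ hv fun b hb => ?_)
    obtain ⟨j, hj, rfl⟩ := List.getElem_of_mem hb
    rw [eq_factor_iff] at hX1
    have h1 := hX1 (j + 1) (by simp [hv, hj])
    simp only [hv, FreeMonoid.toList_mul, FreeMonoid.toList_of, List.singleton_append,
      List.getElem_cons_succ] at h1
    rw [h1]
    exact H _ (by omega)
  | succ n ih =>
    obtain ⟨i, hi, hslow⟩ := ih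
    have h1 : ∃ b ∈ (φ (FreeMonoid.of (X i))).toList, ¬ IsSlow φ θ b := by
      by_contra! H
      exact hslow (isSlow_of_image hφ (by linarith) H)
    obtain ⟨b, hb, hbs⟩ := h1
    obtain ⟨j, hj, rfl⟩ := List.getElem_of_mem hb
    have h2 := hX.map_factor i 1
    have h3 : FreeMonoid.ofList (factor X i 1) = FreeMonoid.of (X i) := by
      simp [factor]
    rw [h3, eq_factor_iff] at h2
    rw [h2 j hj] at hbs
    refine ⟨_, ?_, hbs⟩
    -- the image of the first letter has length at least two
    have h4 : i < (φ (FreeMonoid.ofList (factor X 0 i))).length := by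
      obtain ⟨k, rfl⟩ := Nat.exists_eq_add_of_lt hi
      have h5 : n + k + 1 = 1 + (n + k) := by omega
      have h6 : FreeMonoid.ofList (factor X 0 1) = FreeMonoid.of (X 0) := by
        simp [factor]
      rw [h5, factor_add, FreeMonoid.ofList_append, map_mul, h6, hv]
      simp only [FreeMonoid.length_mul, FreeMonoid.length_of]
      have h7 := hφ.length_le (FreeMonoid.ofList (factor X (0 + 1) (n + k)))
      have h8 : (FreeMonoid.ofList (factor X (0 + 1) (n + k))).length = n + k :=
        length_factor _ _ _
      omega
    omega

/-- The word `C w D` occurs in `X`, where the letters of `w` are slow, and `C`, `D` are fast. -/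
def IsGap (φ : FreeMonoid A →* FreeMonoid A) (θ : ℝ) (X : ℕ → A) (C D : A) (w : List A) : Prop :=
  ¬ IsSlow φ θ C ∧ ¬ IsSlow φ θ D ∧ IsFactor ([C] ++ w ++ [D]) X ∧ ∀ a ∈ w, IsSlow φ θ a

theorem exists_isGap_of_isFactor {X : ℕ → A} (h0 : ¬ IsSlow φ θ (X 0))
    (hfar : ∀ n, ∃ i, n < i ∧ ¬ IsSlow φ θ (X i)) {u : List A} (hu : IsFactor u X)
    (hu0 : u ≠ []) (hslow : ∀ a ∈ u, IsSlow φ θ a) :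
    ∃ C D w, IsGap φ θ X C D w ∧ u <:+: w := by
  classical
  obtain ⟨i, hi⟩ := hu
  have hlen := List.length_pos_iff.2 hu0
  have hmid : ∀ k, i ≤ k → k < i + u.length → IsSlow φ θ (X k) := by
    intro k hk1 hk2
    have h1 := eq_factor_iff.1 hi (k - i) (by omega)
    rw [Nat.add_sub_cancel' hk1] at h1
    rw [← h1]
    exact hslow _ (List.getElem_mem _)
  set l := Nat.findGreatest (fun k => ¬ IsSlow φ θ (X k)) i with hl
  have hlfast : ¬ IsSlow φ θ (X l) :=
    Nat.findGreatest_spec (P := fun k => ¬ IsSlow φ θ (X k)) (Nat.zero_le i) h0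
  have hli : l < i := lt_of_le_of_ne (Nat.findGreatest_le i) fun h =>
    hlfast (h ▸ hmid i le_rfl (by omega))
  set r := Nat.find (hfar l) with hr
  obtain ⟨hlr, hrfast⟩ := Nat.find_spec (hfar l)
  rw [← hr] at hlr hrfast
  have hrmin : ∀ k, l < k → k < r → IsSlow φ θ (X k) := by
    intro k hk1 hk2
    have := Nat.find_min (hfar l) hk2
    by_contra h
    exact this ⟨hk1, h⟩
  have hir : i + u.length ≤ r := by
    by_contra! h
    rcases le_total i r with h1 | h1
    · exact hrfast (hmid r h1 h)
    · exact Nat.findGreatest_is_greatest hlr h1 hrfast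
  refine ⟨X l, X r, factor X (l + 1) (r - (l + 1)), ⟨hlfast, hrfast, ⟨l, ?_⟩, ?_⟩, ?_⟩
  · have h1 : ([X l] ++ factor X (l + 1) (r - (l + 1)) ++ [X r]).length =
        1 + (r - (l + 1)) + 1 := by simp; omega
    rw [h1, factor_add, factor_add]
    have h2 : l + (1 + (r - (l + 1))) = r := by omega
    rw [h2]
    simp [factor]
  · intro a ha
    obtain ⟨k, hk, rfl⟩ := List.getElem_of_mem ha
    rw [getElem_factor]
    rw [length_factor] at hk
    exact hrmin _ (by omega) (by omega)
  · have h1 : r - (l + 1) = (i - (l + 1)) + u.length + (r - (i + u.length)) := by omega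
    have h2 : l + 1 + (i - (l + 1)) = i := by omega
    rw [h1, factor_add, factor_add, h2, hi]
    exact ⟨_, _, rfl⟩

/-- The images under `ψ φⁿ` of infinitely many words `C w D`, with the same fast letters `C` and `D`
and slow words `w` with pairwise different lengths of `ψ φⁿ(w)`, contradict the bound of
`IsLinearlyRecurrent.card_gaps_le` for large `n`. -/
theorem false_of_gaps [Finite A] {ψ : FreeMonoid A →* FreeMonoid B} {X : ℕ → A} {W : ℕ → B}
    {K : ℕ} {c : ℝ} (hψ : IsNonerasing ψ) (hX : IsImage φ X X) (hW : IsImage ψ X W)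
    (hrec : IsLinearlyRecurrent K W) (hper : ¬ IsPeriodic W) (hθ : 1 < θ) (hc : 0 < c)
    (hlow : ∀ a n, c * θ ^ n ≤ (growth φ a n : ℝ)) {C D : A} (w : ℕ → List A)
    (hw : ∀ j, IsGap φ θ X C D (w j))
    (hmono : ∀ n, StrictMono fun j => (ψ (iter φ n (FreeMonoid.ofList (w j)))).length) :
    False := by
  obtain ⟨d, hd1, hd⟩ := exists_length_map_le ψ
  set M := K * (2 * (K + 1)) + 1 with hM
  obtain ⟨T, hT0, hT⟩ := exists_length_iter_le (φ := φ) (w := FreeMonoid.ofList (w M))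
    (show 0 < θ by linarith) (hw M).2.2.2
  obtain ⟨N₁, hN₁⟩ := exists_forall_le_growth (by linarith) hc hlow (hw 0).1
    ((K + 1) * (d * T + 1))
  obtain ⟨N₂, hN₂⟩ := exists_forall_le_growth (by linarith) hc hlow (hw 0).2.1
    ((K + 1) * (d * T + 1))
  set n := max N₁ N₂ with hn
  set h : FreeMonoid A →* FreeMonoid B := ψ.comp (iter φ n) with hh
  have hXW : IsImage h X W := (hX.iter n).comp hW
  have hθn : 1 ≤ θ ^ n := one_le_pow₀ hθ.le
  -- `τ` exceeds the lengths of the images of the slow words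
  set τ := ⌊d * T * θ ^ n⌋₊ + 1 with hτ
  have hτle : ((K + 1) * τ : ℝ) ≤ (K + 1) * (d * T + 1) * θ ^ n := by
    have h1 : (⌊d * T * θ ^ n⌋₊ : ℝ) ≤ d * T * θ ^ n := Nat.floor_le (by positivity)
    have h2 : (τ : ℝ) ≤ (d * T + 1) * θ ^ n := by
      rw [hτ]
      push_cast
      linarith
    rw [mul_assoc]
    gcongr
  have hlong : ∀ a, ((K + 1) * (d * T + 1) * θ ^ n ≤ growth φ a n) →
      (K + 1) * τ ≤ (h (FreeMonoid.of a)).toList.length := by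
    intro a ha
    have h1 : (K + 1) * τ ≤ growth φ a n := by exact_mod_cast hτle.trans ha
    exact h1.trans (hψ.length_le _)
  have hC := hlong C (hN₁ n (le_max_left _ _))
  have hD := hlong D (hN₂ n (le_max_right _ _))
  set L := (K + 1) * τ with hL
  set U := (h (FreeMonoid.of C)).toList with hU
  set V := (h (FreeMonoid.of D)).toList with hV
  have hpos : ∀ j, ∃ i, (∀ k (hk : k < U.length), W (i + k) = U[k]) ∧
      ∀ k (hk : k < V.length),
        W (i + U.length + (h (FreeMonoid.ofList (w j))).length + k) = V[k] := by
    intro j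
    obtain ⟨i, hi⟩ := hXW.isFactor (hw j).2.2.1
    simp only [FreeMonoid.ofList_append, map_mul, FreeMonoid.toList_mul, List.length_append,
      FreeMonoid.ofList_singleton, factor_add] at hi
    have h1 := List.append_inj hi (by simp)
    have h2 := (List.append_inj h1.1 (by simp)).1
    refine ⟨i, fun k hk => (eq_factor_iff.1 h2 k hk).symm, fun k hk => ?_⟩
    have h3 := eq_factor_iff.1 h1.2 k hk
    rw [h3]
    congr 1
    change _ = i + (U.length + (h (FreeMonoid.ofList (w j))).length) + k
    omega
  choose i hi1 hi2 using hpos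
  have hcard := hrec.card_gaps_le hper (M := M) (τ := τ) (Nat.succ_pos _)
    (fun r => W (i 0 + (U.length - L) + r))
    (fun r => W (i 0 + U.length + (h (FreeMonoid.ofList (w 0))).length + r))
    (fun j => i j + (U.length - L)) (fun j => (h (FreeMonoid.ofList (w j))).length)
    (fun j => by
      have h1 : (h (FreeMonoid.ofList (w j))).length ≤ (h (FreeMonoid.ofList (w M))).length :=
        (hmono n).monotone j.2.le
      refine h1.trans_lt (Nat.lt_succ_of_le (Nat.le_floor ?_))
      refine (hd _).trans ?_
      rw [mul_assoc]
      gcongr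
      exact hT n)
    (fun j k hjk => Fin.ext ((hmono n).injective hjk))
    (fun j r hr => by
      rw [← hL] at hr
      simp only [add_assoc]
      rw [hi1 j _ (by omega), hi1 0 _ (by omega)])
    (fun j r hr => by
      rw [← hL] at hr ⊢
      have h1 : i j + (U.length - L) + L = i j + U.length := by omega
      rw [h1, hi2 j _ (by omega), hi2 0 _ (by omega)])
  omega

/-- If some letter is fast, then slow words of unbounded lengths occur between fast letters, since
the words `φᵏ(e)` are slow. -/
theorem isSlow_of_isLinearlyRecurrent [Finite A] {ψ : FreeMonoid A →* FreeMonoid B} {X : ℕ → A}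
    {W : ℕ → B} {K : ℕ} {c : ℝ} (hφ : IsNonerasing φ) (hψ : IsNonerasing ψ) (hX : IsImage φ X X)
    (hW : IsImage ψ X W) (hrec : IsLinearlyRecurrent K W) (hper : ¬ IsPeriodic W) (hθ : 1 < θ)
    (hc : 0 < c) (hlow : ∀ a n, c * θ ^ n ≤ (growth φ a n : ℝ))
    (hpro : IsProlongable φ (X 0)) (hreach : ∀ a, Reaches φ (X 0) a)
    {e : A} (heX : ∃ i, X i = e) (he : IsSlow φ θ e) (a : A) : IsSlow φ θ a := by
  by_contra ha
  have hθ0 : 0 < θ := by linarith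
  have h0 : ¬ IsSlow φ θ (X 0) := fun h => ha (h.of_reaches (hreach a))
  have hfar := exists_lt_not_isSlow hφ hX hpro hθ h0
  have hgap : ∀ T : ℝ, ∃ C D w, IsGap φ θ X C D w ∧
      ∀ n, T * θ ^ n ≤ (iter φ n (FreeMonoid.ofList w)).length := by
    intro T
    obtain ⟨k, hk⟩ := pow_unbounded_of_one_lt (T / c) hθ
    have hk' : T ≤ c * θ ^ k := by
      rw [div_lt_iff₀ hc] at hk
      linarith
    have hfac : IsFactor (iter φ k (FreeMonoid.of e)).toList X := by
      obtain ⟨i, hi⟩ := heX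
      exact (hX.iter k).isFactor (u := [e]) ⟨i, by simp [factor, hi]⟩
    obtain ⟨C, D, w, hw, hin⟩ := exists_isGap_of_isFactor h0 hfar hfac
      (fun h => hφ.iter k e (FreeMonoid.toList.injective h)) fun b hb => he.of_reaches ⟨k, hb⟩
    refine ⟨C, D, w, hw, fun n => ?_⟩
    have h1 : growth φ e (n + k) ≤ (iter φ n (FreeMonoid.ofList w)).length := by
      unfold growth
      rw [iter_add]
      exact (infix_map (h := iter φ n) hin).length_le
    calc T * θ ^ n ≤ c * θ ^ k * θ ^ n := by gcongr
      _ = c * θ ^ (n + k) := by ring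
      _ ≤ growth φ e (n + k) := hlow e _
      _ ≤ _ := by exact_mod_cast h1
  -- the two fast letters can be fixed by the pigeonhole principle
  obtain ⟨C, D, hCD⟩ : ∃ C D, ∀ T : ℝ, ∃ w, IsGap φ θ X C D w ∧
      ∀ n, T * θ ^ n ≤ (iter φ n (FreeMonoid.ofList w)).length := by
    by_contra! H
    choose T hT using fun p : A × A => H p.1 p.2
    obtain ⟨M, hM⟩ := Finite.exists_le T
    obtain ⟨C, D, w, hw, hwn⟩ := hgap M
    obtain ⟨n, hn⟩ := hT (C, D) w hw
    have h1 : T (C, D) * θ ^ n ≤ M * θ ^ n := by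
      gcongr
      exact hM _
    linarith [hwn n]
  have hnext : ∀ w : {w // IsGap φ θ X C D w}, ∃ w' : {w // IsGap φ θ X C D w}, ∀ n,
      (ψ (iter φ n (FreeMonoid.ofList w.1))).length <
        (ψ (iter φ n (FreeMonoid.ofList w'.1))).length := by
    rintro ⟨w, hw⟩
    obtain ⟨T, hT0, hT⟩ := exists_length_iter_le (φ := φ) (w := FreeMonoid.ofList w) hθ0 hw.2.2.2
    obtain ⟨d, hd1, hd⟩ := exists_length_map_le ψ
    obtain ⟨w', hw', hwn⟩ := hCD (d * T + 1)
    refine ⟨⟨w', hw'⟩, fun n => ?_⟩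
    have h1 : ((iter φ n (FreeMonoid.ofList w')).length : ℝ) ≤
        (ψ (iter φ n (FreeMonoid.ofList w'))).length := by
      exact_mod_cast hψ.length_le _
    have h2 : ((ψ (iter φ n (FreeMonoid.ofList w))).length : ℝ) ≤ d * (T * θ ^ n) :=
      (hd _).trans (by gcongr; exact hT n)
    have h3 : 0 < θ ^ n := pow_pos hθ0 n
    have h4 : ((ψ (iter φ n (FreeMonoid.ofList w))).length : ℝ) <
        (ψ (iter φ n (FreeMonoid.ofList w'))).length := by linarith [hwn n]
    exact_mod_cast h4
  choose next hnext using hnext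
  obtain ⟨w₀, hw₀, -⟩ := hCD 0
  refine false_of_gaps hψ hX hW hrec hper hθ hc hlow (fun j => (next^[j] ⟨w₀, hw₀⟩).1)
    (fun j => (next^[j] ⟨w₀, hw₀⟩).2) fun n => strictMono_nat_of_lt_succ fun j => ?_
  rw [Function.iterate_succ_apply']
  exact hnext _ n

end Slow

/-! ### Growth orders -/

section GrowthOrder

variable {A : Type*} {φ : FreeMonoid A →* FreeMonoid A}

theorem hasGrowthOrder_zero {a : A} {θ c C : ℝ} (hθ : 0 < θ) (hc : 0 < c)
    (hlow : ∀ n, c * θ ^ n ≤ (growth φ a n : ℝ)) (hup : ∀ n, (growth φ a n : ℝ) ≤ C * θ ^ n) :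
    HasGrowthOrder φ (FreeMonoid.of a) 0 θ := by
  have hcC : c ≤ C := by simpa using (hlow 0).trans (hup 0)
  refine ⟨hθ, c / 2, C + 1, by linarith, by linarith, fun n _ => ?_⟩
  have h1 := hlow n
  have h2 := hup n
  have h3 : 0 < θ ^ n := pow_pos hθ n
  have h4 : 0 < c * θ ^ n := mul_pos hc h3
  unfold growth at h1 h2
  rw [iter_apply] at h1 h2
  rw [pow_zero, one_mul]
  constructor <;> linarith

theorem HasGrowthOrder.le_zero {a : A} {θ C : ℝ} (hθ : 0 < θ)
    (hup : ∀ n, (growth φ a n : ℝ) ≤ C * θ ^ n) {d : ℕ} {θ' : ℝ}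
    (h : HasGrowthOrder φ (FreeMonoid.of a) d θ') : GrowthOrderLE d θ' 0 θ := by
  obtain ⟨-, c, _, hc, -, hcn⟩ := h
  have hle : ∀ n : ℕ, 1 ≤ n → (n : ℝ) ^ d * (θ' / θ) ^ n ≤ C / c := by
    intro n hn
    have h1 := (hcn n hn).1
    have h2 := hup n
    unfold growth at h2
    rw [iter_apply] at h2
    have h3 : 0 < θ ^ n := pow_pos hθ n
    rw [div_pow, ← mul_div_assoc, div_le_div_iff₀ h3 hc]
    linarith
  rcases lt_trichotomy θ' θ with h1 | rfl | h1
  · exact Or.inl h1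
  · refine Or.inr ⟨rfl, ?_⟩
    by_contra! hd
    obtain ⟨N, hN⟩ := exists_nat_gt (C / c)
    have h2 := hle (N + 1) (by omega)
    rw [div_self hθ.ne', one_pow, mul_one] at h2
    have h3 : ((N + 1 : ℕ) : ℝ) ≤ ((N + 1 : ℕ) : ℝ) ^ d :=
      le_self_pow₀ (by simp) (by omega)
    push_cast at h2 h3
    linarith
  · exfalso
    have h2 : 1 < θ' / θ := (one_lt_div hθ).2 h1
    obtain ⟨N, hN⟩ := pow_unbounded_of_one_lt (C / c) h2
    have h3 := hle (N + 1) (by omega)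
    have h4 : (1 : ℝ) ≤ ((N + 1 : ℕ) : ℝ) ^ d := one_le_pow₀ (by simp)
    have h5 : (θ' / θ) ^ N ≤ (θ' / θ) ^ (N + 1) := pow_le_pow_right₀ h2.le (by omega)
    have h6 : 1 * (θ' / θ) ^ (N + 1) ≤ ((N + 1 : ℕ) : ℝ) ^ d * (θ' / θ) ^ (N + 1) := by gcongr
    linarith

end GrowthOrder

end MorphicWord

open MorphicWord in
theorem mainTheorem4 {A B : Type*} [Finite A]
    (φ : FreeMonoid A →* FreeMonoid A) (ψ : FreeMonoid A →* FreeMonoid B) (a₁ : A)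
    (hφ : MorphicWord.IsProlongable φ a₁)
    (hψ : MorphicWord.IsNonerasing ψ)
    (hgrow : ∀ a : A, MorphicWord.IsGrowing φ (FreeMonoid.of a))
    (hocc : ∀ a : A, ∃ n : ℕ, MorphicWord.infiniteIterate φ a₁ hφ n = a)
    (hnonper : ¬ MorphicWord.IsPeriodic
      (MorphicWord.mapInfinite ψ hψ (MorphicWord.infiniteIterate φ a₁ hφ)))
    (hrec : MorphicWord.IsUniformlyRecurrent
      (MorphicWord.mapInfinite ψ hψ (MorphicWord.infiniteIterate φ a₁ hφ))) :
    ∃ (D : ℕ) (Θ : ℝ), MorphicWord.IsMaxGrowthOrder φ D Θ ∧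
      ∀ a : A, MorphicWord.HasGrowthOrder φ (FreeMonoid.of a) D Θ := by
  have : Nonempty A := ⟨a₁⟩
  have hX := isImage_infiniteIterate hφ
  have hW := isImage_mapInfinite hψ (infiniteIterate φ a₁ hφ)
  obtain ⟨e, he, θ, hθ, heT, c, hc, hlow⟩ := exists_isTerminal_minimal_growth hgrow
  obtain ⟨K, hK⟩ := exists_isLinearlyRecurrent hgrow hψ hX hW hrec (hocc e) he
  have hX0 : infiniteIterate φ a₁ hφ 0 = a₁ := rfl
  have hreach : ∀ a, Reaches φ (infiniteIterate φ a₁ hφ 0) a := by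
    intro a
    obtain ⟨n, rfl⟩ := hocc a
    refine ⟨n, ?_⟩
    rw [hX0, iter_apply]
    exact List.getElem_mem _
  have hslow : ∀ a, IsSlow φ θ a := isSlow_of_isLinearlyRecurrent (nonerasing_of_growing hgrow) hψ
    hX hW hK hnonper hθ hc hlow (hX0.symm ▸ hφ) hreach (hocc e) heT
  have hθ0 : 0 < θ := by linarith
  have horder : ∀ a, HasGrowthOrder φ (FreeMonoid.of a) 0 θ := fun a => by
    obtain ⟨T, hT⟩ := hslow a
    exact hasGrowthOrder_zero hθ0 hc (hlow a) hT
  refine ⟨0, θ, ⟨⟨a₁, horder a₁⟩, fun a d θ' h => ?_⟩, horder⟩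
  obtain ⟨T, hT⟩ := hslow a
  exact h.le_zero hθ0 hT
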